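/- Let $b \ge 2$ be an integer and let $\mathbf a \ne \mathbf b$ be elements of $\{0,1,\dots,b-1\}$. Let $\theta,\rho$ be real numbers with $0\le\theta,\rho<1$ and $\theta$ irrational. For $n\ge 0$ put $$s_n=\lfloor (n+1)\theta+\rho\rfloor-\lfloor n\theta+\rho\rfloor,\qquad s'_n=\lceil (n+1)\theta+\rho\rceil-\lceil n\theta+\rho\rceil ,$$ and call $s_0s_1s_2\ldots$ and $s'_0s'_1s'_2\ldots$ the lower and the upper Sturmian word over $\{0,1\}$ of slope $\theta$ and intercept $\rho$. A Sturmian word of slope $\theta$ and intercept $\rho$ over $\{\mathbf a,\mathbf b\}$ is one of these two words with $0$ replaced by $\mathbf a$ and $1$ by $\mathbf b$. The characteristic Sturmian word of slope $\theta$ over $\{0,1\}$ is the lower Sturmian word of slope $\theta$ and intercept $0$ without its first letter, that is, $(\lfloor (n+1)\theta\rfloor-\lfloor n\theta\rfloor)_{n\ge 1}$; let $c_1c_2c_3\ldots$ be this word with $0$ replaced by $\mathbf a$ and $1$ by $\mathbf b$. Let $\mathbf x=x_1x_2x_3\ldots$ be a Sturmian word of slope $\theta$ and intercept $\rho$ over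 $\{\mathbf a,\mathbf b\}$, and set $$\xi_0=\sum_{n=1}^\infty \frac{c_n}{b^n},\qquad \xi_1=\xi_{\mathbf x}=\sum_{n=1}^\infty \frac{x_n}{b^n}.$$ Then $1,\xi_0,\xi_1$ are linearly independent over $\mathbb Q$ if and only if there is no integer $j$ such that $\rho$ is congruent to $j\theta$ modulo one. -/

import Mathlib

namespace Sturmian

/-- The lower Sturmian word of slope `θ` and intercept `ρ` (letters `0`, `1`, indexed from `0`). -/
noncomputable def lower (θ ρ : ℝ) (n : ℕ) : ℤ :=
  ⌊((n : ℝ) + 1) * θ + ρ⌋ - ⌊(n : ℝ) * θ + ρ⌋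

/-- The upper Sturmian word of slope `θ` and intercept `ρ` (letters `0`, `1`, indexed from `0`). -/
noncomputable def upper (θ ρ : ℝ) (n : ℕ) : ℤ :=
  ⌈((n : ℝ) + 1) * θ + ρ⌉ - ⌈(n : ℝ) * θ + ρ⌉

/-- The characteristic Sturmian word of slope `θ`: the lower Sturmian word of intercept `0`
without its first letter. -/
noncomputable def characteristic (θ : ℝ) (n : ℕ) : ℤ :=
  lower θ 0 (n + 1)

/-- Replace the letter `0` by `A` and the letter `1` by `B` in a word over `{0, 1}`. -/
def recode {α : Type*} (A B : α) (w : ℕ → ℤ) (n : ℕ) : α :=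
  if w n = 0 then A else B

/-- `x` is a Sturmian word of slope `θ` and intercept `ρ` over `{A, B}`, lower or upper. -/
def IsSturmian {α : Type*} (A B : α) (θ ρ : ℝ) (x : ℕ → α) : Prop :=
  x = recode A B (lower θ ρ) ∨ x = recode A B (upper θ ρ)

end Sturmian

namespace Sturmian

open Filter
open scoped Topology

/-! Let G(t) be the sum of ⌊nθ + t⌋ / b^n over n ≥ 1. The value of a lower word of intercept ρ is a
nonconstant rational affine function of G(ρ), and the characteristic word has intercept θ. Since G(t
+ θ) = b G(t) - ⌊t + θ⌋ and G(t + 1) = G(t) + 1/(b - 1), on the orbit ℤθ + ℤ every value of G is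
rationally dependent on 1 and G(0). The ceiling behaves alike, which settles intercepts on the
orbit.

Conversely, suppose q₀ + q₁ G(u) + q₂ G(v) = 0 with integers qᵢ and v - u off the orbit. The same
identities give D(t) = q₁ G(u + t) + q₂ G(v + t) values in ℤ/(b - 1) on the dense set of all nθ + m,
n ≥ 0. Its one-sided limits, hence its jumps, then lie in ℤ/(b - 1) everywhere. But G jumps only on
the orbit, by b^(-n) at -nθ, so D jumps by q₁ b^(-n) at -u - nθ for every n ≥ 1, which forces q₁ = 0
(`coeff_eq_zero_of_relation`). -/

/-- A monotone integer-valued function on `ℝ` which commutes with the translation by `1` and stays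
at distance at most `1` from the identity, such as the floor and the ceiling. -/
structure IsRounding (f : ℝ → ℤ) : Prop where
  mono : Monotone f
  add_one : ∀ t, f (t + 1) = f t + 1
  abs_sub_le : ∀ t, |(f t : ℝ) - t| ≤ 1

theorem isRounding_floor : IsRounding (fun t ↦ ⌊t⌋) where
  mono := Int.floor_mono
  add_one := Int.floor_add_one
  abs_sub_le t := by
    rw [abs_le]
    constructor <;> linarith [Int.floor_le t, Int.lt_floor_add_one t]

theorem isRounding_ceil : IsRounding (fun t ↦ ⌈t⌉) where
  mono := Int.ceil_mono
  add_one := Int.ceil_add_one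
  abs_sub_le t := by
    rw [abs_le]
    constructor <;> linarith [Int.le_ceil t, Int.ceil_lt_add_one t]

/-- This is the left limit of the floor, needed for the left limits of the series. -/
theorem isRounding_ceil_sub_one : IsRounding (fun t ↦ ⌈t⌉ - 1) where
  mono _ _ h := sub_le_sub_right (Int.ceil_mono h) 1
  add_one t := by simp
  abs_sub_le t := by
    push_cast
    rw [abs_le]
    constructor <;> linarith [Int.le_ceil t, Int.ceil_lt_add_one t]

theorem IsRounding.add_intCast {f : ℝ → ℤ} (hf : IsRounding f) (t : ℝ) (m : ℤ) :
    f (t + m) = f t + m := by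
  induction m using Int.induction_on with
  | zero => simp
  | succ k ih =>
    have := hf.add_one (t + (k : ℤ))
    push_cast at this ih ⊢
    rw [← add_assoc, this, ih, add_assoc]
  | pred k ih =>
    have := hf.add_one (t + ((-k - 1 : ℤ) : ℝ))
    rw [show t + ((-k - 1 : ℤ) : ℝ) + 1 = t + ((-k : ℤ) : ℝ) by push_cast; ring, ih] at this
    linarith

theorem IsRounding.abs_le {f : ℝ → ℤ} (hf : IsRounding f) (t : ℝ) : |(f t : ℝ)| ≤ |t| + 1 := by
  have := abs_add_le ((f t : ℝ) - t) t
  rw [sub_add_cancel] at this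
  linarith [hf.abs_sub_le t]

/-! ### The series and its functional equations -/

/-- The series `∑ f (n θ + t) / b ^ n` over `n ≥ 1`. -/
noncomputable def roundingSeries (b : ℕ) (θ : ℝ) (f : ℝ → ℤ) (t : ℝ) : ℝ :=
  ∑' n : ℕ, (f (((n : ℝ) + 1) * θ + t) : ℝ) * ((b : ℝ) ^ (n + 1))⁻¹

variable {b : ℕ} {θ : ℝ} {f : ℝ → ℤ}

theorem hasSum_inv_pow_succ (hb : 2 ≤ b) :
    HasSum (fun n : ℕ ↦ ((b : ℝ) ^ (n + 1))⁻¹) (1 / ((b : ℝ) - 1)) := by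
  have hb' : (2 : ℝ) ≤ b := by exact_mod_cast hb
  have h := (hasSum_geometric_of_lt_one (r := (b : ℝ)⁻¹) (by positivity)
    (inv_lt_one_of_one_lt₀ (by linarith))).mul_left (b : ℝ)⁻¹
  have h1 : (b : ℝ) - 1 ≠ 0 := by linarith
  have h2 : (b : ℝ) ≠ 0 := by linarith
  convert! h using 1
  · ext n
    rw [pow_succ', mul_inv, inv_pow]
  · field_simp

theorem summable_linear_mul_inv_pow_succ (hb : 2 ≤ b) (c d : ℝ) :
    Summable (fun n : ℕ ↦ (((n : ℝ) + 1) * c + d) * ((b : ℝ) ^ (n + 1))⁻¹) := by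
  have hb' : (2 : ℝ) ≤ b := by exact_mod_cast hb
  have h := summable_pow_mul_geometric_of_norm_lt_one 1 (r := (b : ℝ)⁻¹)
    (by rw [norm_inv, Real.norm_natCast]; exact inv_lt_one_of_one_lt₀ (by linarith))
  have h1 := (((summable_nat_add_iff 1).2 h).mul_left c).add
    ((hasSum_inv_pow_succ hb).summable.mul_left d)
  refine h1.congr fun n ↦ ?_
  push_cast
  rw [inv_pow]
  ring

theorem IsRounding.norm_term_le (hf : IsRounding f) (b : ℕ) (θ : ℝ) {t r : ℝ} (ht : |t| ≤ r)
    (n : ℕ) :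
    ‖(f (((n : ℝ) + 1) * θ + t) : ℝ) * ((b : ℝ) ^ (n + 1))⁻¹‖ ≤
      (((n : ℝ) + 1) * |θ| + (r + 1)) * ((b : ℝ) ^ (n + 1))⁻¹ := by
  rw [norm_mul, Real.norm_eq_abs,
    Real.norm_of_nonneg (by positivity : (0 : ℝ) ≤ ((b : ℝ) ^ (n + 1))⁻¹)]
  gcongr
  have h1 := hf.abs_le (((n : ℝ) + 1) * θ + t)
  have h2 := abs_add_le (((n : ℝ) + 1) * θ) t
  rw [abs_mul, abs_of_nonneg (by positivity : (0 : ℝ) ≤ (n : ℝ) + 1)] at h2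
  linarith

theorem IsRounding.hasSum (hf : IsRounding f) (hb : 2 ≤ b) (θ t : ℝ) :
    HasSum (fun n : ℕ ↦ (f (((n : ℝ) + 1) * θ + t) : ℝ) * ((b : ℝ) ^ (n + 1))⁻¹)
      (roundingSeries b θ f t) :=
  (Summable.of_norm_bounded (summable_linear_mul_inv_pow_succ hb |θ| (|t| + 1))
    (hf.norm_term_le b θ le_rfl)).hasSum

theorem IsRounding.hasSum_shift (hf : IsRounding f) (hb : 2 ≤ b) (θ t : ℝ) :
    HasSum (fun n : ℕ ↦ (f ((n : ℝ) * θ + t) : ℝ) * ((b : ℝ) ^ (n + 1))⁻¹)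
      ((b : ℝ)⁻¹ * (f t + roundingSeries b θ f t)) := by
  have h : HasSum (fun n : ℕ ↦ (f ((n : ℝ) * θ + t) : ℝ) * ((b : ℝ) ^ n)⁻¹)
      (f t + roundingSeries b θ f t) := by
    rw [← hasSum_nat_add_iff' 1]
    simpa using hf.hasSum hb θ t
  refine (h.mul_left (b : ℝ)⁻¹).congr_fun fun n ↦ ?_
  rw [pow_succ', mul_inv]
  ring

theorem IsRounding.roundingSeries_add_intCast (hf : IsRounding f) (hb : 2 ≤ b) (θ t : ℝ) (m : ℤ) :
    roundingSeries b θ f (t + m) = roundingSeries b θ f t + m / ((b : ℝ) - 1) := by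
  refine (hf.hasSum hb θ (t + m)).unique ?_
  have h := (hf.hasSum hb θ t).add ((hasSum_inv_pow_succ hb).mul_left (m : ℝ))
  rw [mul_one_div] at h
  refine h.congr_fun fun n ↦ ?_
  rw [← add_assoc, hf.add_intCast]
  push_cast
  ring

theorem IsRounding.roundingSeries_add_slope (hf : IsRounding f) (hb : 2 ≤ b) (θ t : ℝ) :
    roundingSeries b θ f (t + θ) = b * roundingSeries b θ f t - f (t + θ) := by
  have hb0 : (b : ℝ) ≠ 0 := by positivity
  have h1 := hf.hasSum_shift hb θ (t + θ)
  have h2 : HasSum (fun n : ℕ ↦ (f ((n : ℝ) * θ + (t + θ)) : ℝ) * ((b : ℝ) ^ (n + 1))⁻¹)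
      (roundingSeries b θ f t) := by
    refine (hf.hasSum hb θ t).congr_fun fun n ↦ ?_
    rw [show (n : ℝ) * θ + (t + θ) = ((n : ℝ) + 1) * θ + t by ring]
  rw [h2.unique h1]
  field_simp
  ring

/-! ### One-sided limits and jumps -/

/-- If each term of the series for `f` is eventually equal to the term for `g` at `t₀`, then the
series converges to its value for `g`. -/
theorem IsRounding.tendsto_roundingSeries {g : ℝ → ℤ} (hf : IsRounding f) (hb : 2 ≤ b) (θ u : ℝ)
    {t₀ : ℝ} {l : Filter ℝ} (hl : l ≤ 𝓝 t₀)
    (h : ∀ n : ℕ, ∀ᶠ t in l,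
      f (((n : ℝ) + 1) * θ + (u + t)) = g (((n : ℝ) + 1) * θ + (u + t₀))) :
    Tendsto (fun t ↦ roundingSeries b θ f (u + t)) l (𝓝 (roundingSeries b θ g (u + t₀))) := by
  unfold roundingSeries
  refine tendsto_tsum_of_dominated_convergence
    (summable_linear_mul_inv_pow_succ hb |θ| (|u| + (|t₀| + 1) + 1)) (fun n ↦ ?_) ?_
  · refine Tendsto.mul_const _ (tendsto_const_nhds.congr' ?_)
    filter_upwards [h n] with t ht
    rw [ht]
  · have : ∀ᶠ t in 𝓝 t₀, |t| < |t₀| + 1 :=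
      continuous_abs.continuousAt.eventually_lt_const (lt_add_one _)
    filter_upwards [hl this] with t ht n
    refine hf.norm_term_le b θ ?_ n
    have := abs_add_le u t
    linarith

theorem tendsto_roundingSeries_floor_right (hb : 2 ≤ b) (θ u t₀ : ℝ) :
    Tendsto (fun t ↦ roundingSeries b θ (fun t ↦ ⌊t⌋) (u + t)) (𝓝[>] t₀)
      (𝓝 (roundingSeries b θ (fun t ↦ ⌊t⌋) (u + t₀))) := by
  refine isRounding_floor.tendsto_roundingSeries hb θ u nhdsWithin_le_nhds fun n ↦ ?_
  have h : Tendsto (fun t ↦ ((n : ℝ) + 1) * θ + (u + t)) (𝓝[>] t₀)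
      (𝓝[≥] (((n : ℝ) + 1) * θ + (u + t₀))) := by
    refine tendsto_nhdsWithin_iff.2 ⟨?_, ?_⟩
    · exact (Continuous.tendsto (by fun_prop) t₀).mono_left nhdsWithin_le_nhds
    · filter_upwards [self_mem_nhdsWithin] with t ht
      simpa using (Set.mem_Ioi.1 ht).le
  exact tendsto_pure.1 ((tendsto_floor_right_pure_floor _).comp h)

theorem tendsto_roundingSeries_floor_left (hb : 2 ≤ b) (θ u t₀ : ℝ) :
    Tendsto (fun t ↦ roundingSeries b θ (fun t ↦ ⌊t⌋) (u + t)) (𝓝[<] t₀)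
      (𝓝 (roundingSeries b θ (fun t ↦ ⌈t⌉ - 1) (u + t₀))) := by
  refine isRounding_floor.tendsto_roundingSeries hb θ u nhdsWithin_le_nhds fun n ↦ ?_
  have h : Tendsto (fun t ↦ ((n : ℝ) + 1) * θ + (u + t)) (𝓝[<] t₀)
      (𝓝[<] (((n : ℝ) + 1) * θ + (u + t₀))) := by
    refine tendsto_nhdsWithin_iff.2 ⟨?_, ?_⟩
    · exact (Continuous.tendsto (by fun_prop) t₀).mono_left nhdsWithin_le_nhds
    · filter_upwards [self_mem_nhdsWithin] with t ht
      simpa using ht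
  exact tendsto_pure.1 ((tendsto_floor_left_pure_ceil_sub_one _).comp h)

/-- The jump of the floor series at `t` collects the terms at which `n θ + t` is an integer. -/
theorem hasSum_jump (hb : 2 ≤ b) (θ t : ℝ) :
    HasSum (fun n : ℕ ↦ ((⌊((n : ℝ) + 1) * θ + t⌋ - (⌈((n : ℝ) + 1) * θ + t⌉ - 1) : ℤ) : ℝ) *
        ((b : ℝ) ^ (n + 1))⁻¹)
      (roundingSeries b θ (fun t ↦ ⌊t⌋) t - roundingSeries b θ (fun t ↦ ⌈t⌉ - 1) t) := by
  refine ((isRounding_floor.hasSum hb θ t).sub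
    (isRounding_ceil_sub_one.hasSum hb θ t)).congr_fun fun n ↦ ?_
  push_cast
  ring

theorem ceil_eq_floor_add_one_of_forall_ne {y : ℝ} (h : ∀ k : ℤ, y ≠ k) : ⌈y⌉ = ⌊y⌋ + 1 :=
  (Int.ceil_eq_floor_add_one_iff_notMem y).2 fun ⟨k, hk⟩ ↦ h k hk.symm

theorem jump_eq_zero (hb : 2 ≤ b) {t : ℝ} (h : ∀ j m : ℤ, t ≠ j * θ + m) :
    roundingSeries b θ (fun t ↦ ⌊t⌋) t - roundingSeries b θ (fun t ↦ ⌈t⌉ - 1) t = 0 := by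
  refine (hasSum_jump hb θ t).unique (hasSum_zero.congr_fun fun n ↦ ?_)
  rw [ceil_eq_floor_add_one_of_forall_ne (y := ((n : ℝ) + 1) * θ + t)]
  · simp
  · intro k hk
    refine h (-(n + 1)) k ?_
    push_cast
    linarith

theorem intCast_mul_ne_intCast (hθ : Irrational θ) {j : ℤ} (hj : j ≠ 0) (k : ℤ) :
    (j : ℝ) * θ ≠ k :=
  (hθ.intCast_mul hj).ne_int k

/-- By irrationality (n - m)θ is an integer only for n = m, so a single term jumps. -/
theorem jump_neg_mul_slope (hb : 2 ≤ b) (hθ : Irrational θ) (m : ℕ) :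
    roundingSeries b θ (fun t ↦ ⌊t⌋) (-(((m : ℝ) + 1) * θ)) -
      roundingSeries b θ (fun t ↦ ⌈t⌉ - 1) (-(((m : ℝ) + 1) * θ)) = ((b : ℝ) ^ (m + 1))⁻¹ := by
  refine (hasSum_jump hb θ _).unique ?_
  have h := hasSum_single (f := fun n : ℕ ↦ ((⌊((n : ℝ) + 1) * θ + -(((m : ℝ) + 1) * θ)⌋ -
    (⌈((n : ℝ) + 1) * θ + -(((m : ℝ) + 1) * θ)⌉ - 1) : ℤ) : ℝ) * ((b : ℝ) ^ (n + 1))⁻¹) m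
    fun n hn ↦ ?_
  · simpa using h
  · rw [ceil_eq_floor_add_one_of_forall_ne]
    · simp
    · intro k hk
      refine intCast_mul_ne_intCast hθ (j := n - m) (by omega) k ?_
      push_cast
      linarith

/-! ### Independence off the orbit -/

/-- The forward orbit of an irrational rotation is dense. -/
theorem dense_natCast_mul_add_intCast (hθ : Irrational θ) :
    Dense {t : ℝ | ∃ (n : ℕ) (m : ℤ), t = n * θ + m} := by
  have h1 : DenseRange (· • (θ : AddCircle (1 : ℝ)) : ℤ → AddCircle (1 : ℝ)) :=
    AddCircle.denseRange_zsmul_coe_iff.2 (by simpa using hθ)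
  -- In a compact group a submonoid is dense as soon as the subgroup it generates is.
  have h2 : Dense (AddSubmonoid.closure {(θ : AddCircle (1 : ℝ))} : Set (AddCircle (1 : ℝ))) := by
    rw [dense_addSubmonoidClosure_iff_addSubgroupClosure, ← AddSubgroup.zmultiples_eq_closure,
      AddSubgroup.coe_zmultiples]
    exact h1
  refine (h2.preimage (QuotientAddGroup.isOpenMap_coe (G := ℝ))).mono fun t ht ↦ ?_
  obtain ⟨n, hn⟩ := AddSubmonoid.mem_closure_singleton.1 ht
  have hn' : ((t - n * θ : ℝ) : AddCircle (1 : ℝ)) = 0 := by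
    rw [← nsmul_eq_mul, AddCircle.coe_sub, AddCircle.coe_nsmul, hn]
    exact sub_self _
  obtain ⟨m, hm⟩ := (AddCircle.coe_eq_zero_iff _).1 hn'
  refine ⟨n, m, ?_⟩
  rw [zsmul_eq_mul, mul_one] at hm
  linarith

/-- Since `U` is open, `S` stays dense in it, so the limit can be taken along `S`, and the integers
are closed. -/
theorem exists_intCast_eq_of_tendsto {S U : Set ℝ} (hS : Dense S) (hU : IsOpen U) {t₀ y : ℝ}
    (ht₀ : t₀ ∈ closure U) {F : ℝ → ℝ} (hF : ∀ t ∈ S, ∃ k : ℤ, F t = k)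
    (h : Tendsto F (𝓝[U] t₀) (𝓝 y)) : ∃ k : ℤ, y = k := by
  have hmem : t₀ ∈ closure (U ∩ S) :=
    closure_minimal (hS.open_subset_closure_inter hU) isClosed_closure ht₀
  have := mem_closure_iff_nhdsWithin_neBot.1 hmem
  obtain ⟨k, hk⟩ := Int.isClosedEmbedding_coe_real.isClosed_range.mem_of_tendsto
    (h.mono_left (nhdsWithin_mono t₀ Set.inter_subset_left))
    (eventually_nhdsWithin_of_forall fun t ht ↦ (hF t ht.2).imp fun _ ↦ Eq.symm)
  exact ⟨k, hk.symm⟩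

/-- In an integer relation between `1` and the floor series at two points of distinct orbits, the
coefficients of the series vanish. -/
theorem coeff_eq_zero_of_relation (hb : 2 ≤ b) (hθ : Irrational θ) {u v : ℝ}
    (huv : ∀ j m : ℤ, v - u ≠ j * θ + m) {q₀ q₁ q₂ : ℤ}
    (h : (q₀ : ℝ) + q₁ * roundingSeries b θ (fun t ↦ ⌊t⌋) u +
      q₂ * roundingSeries b θ (fun t ↦ ⌊t⌋) v = 0) : q₁ = 0 := by
  have hb' : (2 : ℝ) ≤ b := by exact_mod_cast hb
  have hb1 : (b : ℝ) - 1 ≠ 0 := by linarith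
  set G := roundingSeries b θ (fun t ↦ ⌊t⌋) with hG
  set D : ℝ → ℝ := fun t ↦ q₁ * G (u + t) + q₂ * G (v + t) with hD
  -- A forward step multiplies by b and preserves integrality; a backward step would divide by b.
  -- Hence only the forward orbit is used.
  have hD1 (n : ℕ) : ∃ k : ℤ, D (n * θ) = k := by
    induction n with
    | zero =>
      refine ⟨-q₀, ?_⟩
      simp only [hD, Nat.cast_zero, zero_mul, add_zero]
      push_cast
      linarith
    | succ n ih =>
      obtain ⟨k, hk⟩ := ih
      refine ⟨b * k - q₁ * ⌊u + n * θ + θ⌋ - q₂ * ⌊v + n * θ + θ⌋, ?_⟩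
      have e (w : ℝ) : G (w + ((n + 1 : ℕ) : ℝ) * θ) = b * G (w + n * θ) - ⌊w + n * θ + θ⌋ := by
        rw [hG, ← isRounding_floor.roundingSeries_add_slope hb]
        congr 1
        push_cast
        ring
      simp only [hD, e] at hk ⊢
      push_cast
      rw [← hk]
      ring
  -- The factor b - 1 clears the denominator produced by integer translations.
  have hD2 : ∀ t ∈ {t : ℝ | ∃ (n : ℕ) (m : ℤ), t = n * θ + m},
      ∃ k : ℤ, ((b : ℝ) - 1) * D t = k := by
    rintro t ⟨n, m, rfl⟩
    obtain ⟨k, hk⟩ := hD1 n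
    refine ⟨(b - 1) * k + (q₁ + q₂) * m, ?_⟩
    have e (w : ℝ) : G (w + (n * θ + m)) = G (w + n * θ) + m / ((b : ℝ) - 1) := by
      rw [← add_assoc]
      exact isRounding_floor.roundingSeries_add_intCast hb θ _ m
    simp only [hD, e] at hk ⊢
    push_cast
    rw [← hk]
    field_simp
    ring
  have hS := dense_natCast_mul_add_intCast hθ
  have hjump (m : ℕ) : ∃ k : ℤ, ((b : ℝ) - 1) * q₁ * ((b : ℝ) ^ (m + 1))⁻¹ = k := by
    -- Chosen so that u + t₀ = -(m + 1)θ is a jump of `G`, whereas v + t₀ is off the orbit.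
    set t₀ : ℝ := -u - ((m : ℝ) + 1) * θ with ht₀
    obtain ⟨k, hk⟩ := exists_intCast_eq_of_tendsto hS isOpen_Ioi (by simp) hD2
      ((((tendsto_roundingSeries_floor_right hb θ u t₀).const_mul (q₁ : ℝ)).add
        ((tendsto_roundingSeries_floor_right hb θ v t₀).const_mul (q₂ : ℝ))).const_mul
          ((b : ℝ) - 1))
    obtain ⟨l, hl⟩ := exists_intCast_eq_of_tendsto hS isOpen_Iio (by simp) hD2
      ((((tendsto_roundingSeries_floor_left hb θ u t₀).const_mul (q₁ : ℝ)).add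
        ((tendsto_roundingSeries_floor_left hb θ v t₀).const_mul (q₂ : ℝ))).const_mul
          ((b : ℝ) - 1))
    have hu := jump_neg_mul_slope hb hθ m
    rw [show -(((m : ℝ) + 1) * θ) = u + t₀ by rw [ht₀]; ring] at hu
    have hv : G (v + t₀) - roundingSeries b θ (fun t ↦ ⌈t⌉ - 1) (v + t₀) = 0 := by
      refine jump_eq_zero hb fun j i hji ↦ huv (j + m + 1) i ?_
      push_cast
      linarith
    refine ⟨k - l, ?_⟩
    rw [← hu]
    push_cast
    rw [← hk, ← hl]
    linear_combination (-((b : ℝ) - 1) * q₂) * hv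
  -- With m = |(b - 1) q₁|, the power b^(m + 1) exceeds the integer (b - 1) q₁ that it divides.
  obtain ⟨k, hk⟩ := hjump ((b - 1) * q₁ : ℤ).natAbs
  set m := ((b - 1) * q₁ : ℤ).natAbs with hm
  have hdvd : ((b : ℤ) ^ (m + 1)) ∣ (b - 1) * q₁ := by
    refine ⟨k, ?_⟩
    have hpow : (b : ℝ) ^ (m + 1) ≠ 0 := by positivity
    rw [mul_inv_eq_iff_eq_mul₀ hpow] at hk
    have : (((b - 1) * q₁ : ℤ) : ℝ) = (((b : ℤ) ^ (m + 1) * k : ℤ) : ℝ) := by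
      push_cast
      linarith
    exact_mod_cast this
  have hlt : |((b - 1) * q₁ : ℤ)| < (b : ℤ) ^ (m + 1) := by
    rw [Int.abs_eq_natAbs, ← hm]
    have : m < b ^ (m + 1) := (Nat.lt_succ_self m).trans (Nat.lt_pow_self hb)
    exact_mod_cast this
  rcases mul_eq_zero.1 (Int.eq_zero_of_abs_lt_dvd hdvd hlt) with h0 | h0
  · omega
  · exact h0

/-! ### Dependence on the orbit -/

/-- The series at a point of the orbit of `0` is rationally dependent on `1` and its value at `0`. -/
theorem IsRounding.exists_roundingSeries_eq (hf : IsRounding f) (hb : 2 ≤ b) (θ : ℝ) (j m : ℤ) :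
    ∃ r s : ℚ, roundingSeries b θ f (j * θ + m) = r + s * roundingSeries b θ f 0 := by
  have hb0 : (b : ℝ) ≠ 0 := by positivity
  suffices ∃ r s : ℚ, roundingSeries b θ f (j * θ) = r + s * roundingSeries b θ f 0 by
    obtain ⟨r, s, h⟩ := this
    refine ⟨r + m / (b - 1), s, ?_⟩
    rw [hf.roundingSeries_add_intCast hb, h]
    push_cast
    ring
  induction j using Int.induction_on with
  | zero => exact ⟨0, 1, by simp⟩
  | succ k ih =>
    obtain ⟨r, s, h⟩ := ih
    refine ⟨b * r - f (((k : ℤ) : ℝ) * θ + θ), b * s, ?_⟩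
    rw [show (((k : ℤ) + 1 : ℤ) : ℝ) * θ = ((k : ℤ) : ℝ) * θ + θ by push_cast; ring,
      hf.roundingSeries_add_slope hb, h]
    push_cast
    ring
  | pred k ih =>
    obtain ⟨r, s, h⟩ := ih
    have e := hf.roundingSeries_add_slope hb θ (((-k - 1 : ℤ) : ℝ) * θ)
    rw [show ((-k - 1 : ℤ) : ℝ) * θ + θ = ((-k : ℤ) : ℝ) * θ by push_cast; ring, h] at e
    refine ⟨(r + f (((-k : ℤ) : ℝ) * θ)) / b, s / b, ?_⟩
    rw [eq_sub_iff_add_eq] at e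
    rw [← mul_right_inj' hb0, ← e]
    push_cast
    field_simp
    ring

theorem roundingSeries_ceil_zero (hb : 2 ≤ b) (hθ : Irrational θ) :
    roundingSeries b θ (fun t ↦ ⌈t⌉) 0 =
      roundingSeries b θ (fun t ↦ ⌊t⌋) 0 + 1 / ((b : ℝ) - 1) := by
  refine (isRounding_ceil.hasSum hb θ 0).unique
    (((isRounding_floor.hasSum hb θ 0).add (hasSum_inv_pow_succ hb)).congr_fun fun n ↦ ?_)
  rw [ceil_eq_floor_add_one_of_forall_ne]
  · push_cast
    ring
  · intro k hk
    refine intCast_mul_ne_intCast hθ (j := n + 1) (by omega) k ?_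
    push_cast
    linarith

/-! ### From series to Sturmian words -/

/-- The value of a recoded word of increments in terms of the corresponding series. -/
theorem IsRounding.ofDigits_recode (hf : IsRounding f) (hb : 2 ≤ b) (hθ₀ : 0 ≤ θ) (hθ₁ : θ < 1)
    (A B : Fin b) (t : ℝ) {w : ℕ → ℤ}
    (hw : ∀ n : ℕ, w n = f (((n : ℝ) + 1) * θ + t) - f ((n : ℝ) * θ + t)) :
    b * ((b : ℝ) - 1) * Real.ofDigits (recode A B w) =
      (b * A - ((B : ℝ) - A) * (b - 1) * f t) +
        ((B : ℝ) - A) * (b - 1) ^ 2 * roundingSeries b θ f t := by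
  have hb' : (2 : ℝ) ≤ b := by exact_mod_cast hb
  have hb1 : (b : ℝ) - 1 ≠ 0 := by linarith
  have hb0 : (b : ℝ) ≠ 0 := by linarith
  have hw01 (n : ℕ) : w n = 0 ∨ w n = 1 := by
    have h1 : f ((n : ℝ) * θ + t) ≤ f (((n : ℝ) + 1) * θ + t) := hf.mono (by linarith)
    have h2 : f (((n : ℝ) + 1) * θ + t) ≤ f ((n : ℝ) * θ + t + 1) := hf.mono (by linarith)
    rw [hf.add_one] at h2
    rw [hw]
    omega
  -- Each digit is A + (B - A) w n, and summing the increments gives the series minus its shift.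
  have key : HasSum (Real.ofDigitsTerm (recode A B w))
      ((A : ℝ) * (1 / ((b : ℝ) - 1)) + ((B : ℝ) - A) * (roundingSeries b θ f t -
        (b : ℝ)⁻¹ * (f t + roundingSeries b θ f t))) := by
    refine (((hasSum_inv_pow_succ hb).mul_left (A : ℝ)).add
      (((hf.hasSum hb θ t).sub (hf.hasSum_shift hb θ t)).mul_left ((B : ℝ) - A))).congr_fun
        fun n ↦ ?_
    have e : (f (((n : ℝ) + 1) * θ + t) : ℝ) - f ((n : ℝ) * θ + t) = w n := by
      rw [hw]
      push_cast
      rfl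
    rw [← sub_mul, e, Real.ofDigitsTerm, recode]
    rcases hw01 n with h | h <;> simp [h]
    ring
  rw [Real.ofDigits, key.tsum_eq]
  field_simp
  ring

theorem characteristic_eq_lower (θ : ℝ) : characteristic θ = lower θ θ := by
  ext n
  simp only [characteristic, lower]
  push_cast
  congr 2 <;> ring

theorem upper_eq_lower {ρ : ℝ} (h : ∀ j m : ℤ, ρ ≠ j * θ + m) : upper θ ρ = lower θ ρ := by
  have e (n : ℕ) : ⌈(n : ℝ) * θ + ρ⌉ = ⌊(n : ℝ) * θ + ρ⌋ + 1 := by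
    refine ceil_eq_floor_add_one_of_forall_ne fun k hk ↦ h (-n) k ?_
    push_cast
    linarith
  ext n
  have e' := e (n + 1)
  push_cast at e'
  rw [upper, lower, e', e]
  ring

end Sturmian

open Sturmian in
theorem theorem3 (b : ℕ) (hb : 2 ≤ b) (A B : Fin b) (hAB : A ≠ B)
    (θ ρ : ℝ) (hθ₀ : 0 ≤ θ) (hθ₁ : θ < 1) (hθ : Irrational θ) (hρ₀ : 0 ≤ ρ) (hρ₁ : ρ < 1)
    (x : ℕ → Fin b) (hx : Sturmian.IsSturmian A B θ ρ x) :
    LinearIndependent ℚ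
        ![(1 : ℝ), Real.ofDigits (Sturmian.recode A B (Sturmian.characteristic θ)),
          Real.ofDigits x] ↔
      ¬ ∃ j m : ℤ, ρ = j * θ + m := by
  have hb' : (2 : ℝ) ≤ b := by exact_mod_cast hb
  have hb1 : (b : ℝ) - 1 ≠ 0 := by linarith
  have hb0 : (b : ℝ) ≠ 0 := by linarith
  have hBA : (B : ℝ) - A ≠ 0 := by
    rw [sub_ne_zero]
    exact fun h ↦ hAB (Fin.ext (by exact_mod_cast h.symm))
  have h₀ := isRounding_floor.ofDigits_recode hb hθ₀ hθ₁ A B θ (w := characteristic θ)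
    fun n ↦ by rw [characteristic_eq_lower, lower]
  set ξ₀ := Real.ofDigits (recode A B (characteristic θ))
  constructor
  · rintro hli ⟨j, m, rfl⟩
    obtain ⟨r, s, h⟩ : ∃ r s : ℚ, Real.ofDigits x = r + s * ξ₀ := by
      -- The orbit lemma refers to the value at 0, whereas ξ₀ encodes the value at θ.
      have hG0 : roundingSeries b θ (fun t ↦ ⌊t⌋) 0 =
          (roundingSeries b θ (fun t ↦ ⌊t⌋) θ + ⌊θ⌋) / b := by
        have := isRounding_floor.roundingSeries_add_slope hb θ 0
        rw [zero_add] at this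
        field_simp
        linarith
      suffices ∃ (k : ℤ) (r s : ℚ), b * ((b : ℝ) - 1) * Real.ofDigits x =
          (b * A - ((B : ℝ) - A) * (b - 1) * k) +
            ((B : ℝ) - A) * (b - 1) ^ 2 * (r + s * roundingSeries b θ (fun t ↦ ⌊t⌋) 0) by
        obtain ⟨k, r, s, h⟩ := this
        refine ⟨(b * A - ((B : ℚ) - A) * (b - 1) * k +
          ((B : ℚ) - A) * (b - 1) ^ 2 * (r + s * ⌊θ⌋ / b) -
          (b * A - ((B : ℚ) - A) * (b - 1) * ⌊θ⌋) * (s / b)) / (b * (b - 1)), s / b, ?_⟩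
        rw [hG0] at h
        push_cast
        field_simp
        field_simp at h h₀
        linear_combination h - s * h₀
      rcases hx with rfl | rfl
      · obtain ⟨r, s, h⟩ := isRounding_floor.exists_roundingSeries_eq hb θ j m
        exact ⟨_, r, s, h ▸ isRounding_floor.ofDigits_recode hb hθ₀ hθ₁ A B _ fun _ ↦ rfl⟩
      · obtain ⟨r, s, h⟩ := isRounding_ceil.exists_roundingSeries_eq hb θ j m
        refine ⟨⌈j * θ + m⌉, r + s / (b - 1), s, ?_⟩
        rw [isRounding_ceil.ofDigits_recode hb hθ₀ hθ₁ A B (j * θ + m) (w := upper θ (j * θ + m)) fun _ ↦ rfl,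
          h, roundingSeries_ceil_zero hb hθ]
        push_cast
        ring
    have := Fintype.linearIndependent_iff.1 hli ![r, s, -1]
      (by simp [Fin.sum_univ_three, Rat.smul_def, h]) 2
    simp at this
  · intro hρ
    push Not at hρ
    have hxl : x = recode A B (lower θ ρ) := by
      rcases hx with h | h
      · exact h
      · rw [h, upper_eq_lower hρ]
    have h₁ := isRounding_floor.ofDigits_recode hb hθ₀ hθ₁ A B ρ (w := lower θ ρ) fun _ ↦ rfl
    rw [← hxl] at h₁
    -- Clearing denominators: integrality of the coefficients is what the jump argument needs.
    rw [← LinearIndependent.iff_fractionRing ℤ ℚ, Fintype.linearIndependent_iff]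
    intro g hg
    simp only [Fin.sum_univ_three, zsmul_eq_mul, Matrix.cons_val, mul_one] at hg
    have hz : (B - A : ℤ) * (b - 1) ^ 2 ≠ 0 := by
      have : ((B : ℝ) - A) * (b - 1) ^ 2 ≠ 0 := mul_ne_zero hBA (pow_ne_zero 2 hb1)
      exact_mod_cast this
    set q₀ : ℤ := b * (b - 1) * g 0 + g 1 * (b * A - (B - A) * (b - 1) * ⌊θ⌋) +
      g 2 * (b * A - (B - A) * (b - 1) * ⌊ρ⌋) with hq₀
    have hq₀' : (q₀ : ℝ) = b * (b - 1) * g 0 +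
        g 1 * (b * A - ((B : ℝ) - A) * (b - 1) * ⌊θ⌋) +
        g 2 * (b * A - ((B : ℝ) - A) * (b - 1) * ⌊ρ⌋) := by
      rw [hq₀]
      push_cast
      rfl
    have h1 : g 1 = 0 := by
      refine (mul_eq_zero.1 (coeff_eq_zero_of_relation hb hθ (u := θ) (v := ρ) (q₀ := q₀)
        (q₁ := g 1 * ((B - A : ℤ) * (b - 1) ^ 2)) (q₂ := g 2 * ((B - A : ℤ) * (b - 1) ^ 2))
        (fun j m h ↦ hρ (j + 1) m ?_) ?_)).resolve_right hz
      · push_cast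
        linarith
      · rw [hq₀']
        push_cast
        linear_combination (b * ((b : ℝ) - 1)) * hg - g 1 * h₀ - g 2 * h₁
    -- The jump argument kills only the first coefficient, so it is repeated with the two points
    -- exchanged.
    have h2 : g 2 = 0 := by
      refine (mul_eq_zero.1 (coeff_eq_zero_of_relation hb hθ (u := ρ) (v := θ) (q₀ := q₀)
        (q₁ := g 2 * ((B - A : ℤ) * (b - 1) ^ 2)) (q₂ := g 1 * ((B - A : ℤ) * (b - 1) ^ 2))
        (fun j m h ↦ hρ (1 - j) (-m) ?_) ?_)).resolve_right hz
      · push_cast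
        linarith
      · rw [hq₀']
        push_cast
        linear_combination (b * ((b : ℝ) - 1)) * hg - g 1 * h₀ - g 2 * h₁
    have h0 : g 0 = 0 := by
      rw [h1, h2] at hg
      simpa using hg
    intro i
    fin_cases i
    exacts [h0, h1, h2]
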